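/- All graphs are finite and simple. The jump graph $J(G)$ of a graph $G$ has the edges of $G$ as its vertices, and two of them are adjacent in $J(G)$ if and only if they share no endpoint in $G$. Put $J^0(G)=G$ and $J^k(G)=J(J^{k-1}(G))$ for $k\ge 1$. The dissipation number $d(G)$ is the least $k\ge 0$ such that $J^k(G)$ is the empty graph (the graph with no vertices), and $d(G)=\infty$ if there is no such $k$. Let $C_5$ be the cycle on five vertices and let the net graph $N$ be a triangle with one pendant edge attached at each of its three vertices. **Theorem (Exploding Graph Theorem).** Let $G$ be a graph with $d(G)=\infty$ that is not, up to isomorphism and up to adding or deleting isolated vertices, $C_5$ or $N$. Then $|E(J^k(G))|\to\infty$ as $k\to\infty$. In particular, if the sequence $(J^k(G))_{k\ge 0}$ diverges, that is, no $J^k(G)$ is the empty graph and there are no index $K$ and graph $H$ with $J^k(G)\cong H$ for all $k\ge K$, then $|E(J^k(G))|\to\infty$ as $k\to\infty$. -/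

import Mathlib

universe u

namespace JumpGraph

/-- A simple graph bundled with its vertex type. -/
structure Graph : Type (u + 1) where
  /-- the vertex set -/
  V : Type u
  /-- the graph on this vertex set -/
  G : SimpleGraph V

/-- The jump graph `J(G)`: its vertices are the edges of `G`, and two of them are adjacent
if and only if, as edges of `G`, they share no endpoint. -/
def jump {V : Type u} (G : SimpleGraph V) : SimpleGraph G.edgeSet where
  Adj e f := ¬ ∃ v : V, v ∈ (e : Sym2 V) ∧ v ∈ (f : Sym2 V)
  symm := ⟨fun _ _ h ⟨v, hf, he⟩ => h ⟨v, he, hf⟩⟩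
  loopless := ⟨fun e h => h ⟨(e : Sym2 V).out.1, Sym2.out_fst_mem _, Sym2.out_fst_mem _⟩⟩

/-- The iterated jump graph: `J^0(G) = G` and `J^(k+1)(G) = J(J^k(G))`. -/
def iterJump {V : Type u} (G : SimpleGraph V) : ℕ → Graph.{u}
  | 0 => ⟨V, G⟩
  | k + 1 => ⟨(iterJump G k).G.edgeSet, jump (iterJump G k).G⟩

/-- The number of edges of `J^k(G)` (always finite when `G` is finite). -/
noncomputable def numEdges {V : Type u} (G : SimpleGraph V) (k : ℕ) : ℕ :=
  (iterJump G k).G.edgeSet.ncard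

/-- The dissipation number `d(G)`: the least `k` such that `J^k(G)` is the empty graph
(no vertices), and `⊤` if there is no such `k`. -/
noncomputable def d {V : Type u} (G : SimpleGraph V) : ℕ∞ :=
  sInf {n : ℕ∞ | ∃ k : ℕ, n = (k : ℕ∞) ∧ IsEmpty (iterJump G k).V}

/-- `G` and `H` are the same graph up to isolated vertices: they become isomorphic after
all isolated vertices are deleted from both (`support` is the set of non-isolated vertices). -/
def IsoUpToIsolated {V : Type u} {W : Type*} (G : SimpleGraph V) (H : SimpleGraph W) : Prop :=
  Nonempty (G.induce G.support ≃g H.induce H.support)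

/-- The net graph `N`: the triangle `0 1 2` with one pendant edge at each of its vertices. -/
def net : SimpleGraph (Fin 6) :=
  SimpleGraph.fromEdgeSet {s(0, 1), s(1, 2), s(0, 2), s(0, 3), s(1, 4), s(2, 5)}

/-- The sequence `J^k(G)` terminates: some `J^k(G)` is the empty graph. -/
def Terminates {V : Type u} (G : SimpleGraph V) : Prop :=
  ∃ k : ℕ, IsEmpty (iterJump G k).V

/-- The sequence `J^k(G)` converges: there are an index `K` and a graph `H` such that
`J^k(G) ≅ H` for all `k ≥ K`. -/
def Converges {V : Type u} (G : SimpleGraph V) : Prop :=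
  ∃ (K : ℕ) (H : Graph.{u}), ∀ k : ℕ, K ≤ k → Nonempty ((iterJump G k).G ≃g H.G)

/-- The sequence `J^k(G)` diverges: it neither terminates nor converges. -/
def Diverges {V : Type u} (G : SimpleGraph V) : Prop :=
  ¬ Terminates G ∧ ¬ Converges G

end JumpGraph

universe v w

namespace JumpGraph

/-! Jump graphs are monotone: an embedding, ignoring isolated vertices, induces one of the jump
graphs (`EmbedsIn.jump`). Hence termination passes to subgraphs and explosion to supergraphs.

Explosion is certified by a core, a graph with at least eight vertices and minimum degree at least
three. The jump graph of a core is a core with strictly more vertices (`IsCore.jump`), so once some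
iterate contains a core, the edge counts tend to infinity (`Explodes.tendsto`).

It remains to show that a graph that neither terminates nor explodes is C_5 or N up to isolated
vertices (`cycle_or_net_of_not_terminates`). Grow a subgraph of G edge by edge from a single edge.
Stars could grow forever, so if all edges but at most one pass through some vertex, one such vertex
is chosen as centre and only edges off it are added. With this rule only finitely many non-exploding
patterns arise, which a finite computation confirms (`isClosed_eq_true`). In a non-exploding G take
a pattern with as many edges as possible: every edge of G off its centre already belongs to it. If
it has a centre, G is a near-star and terminates. If not, G is the pattern itself, which terminates
or is C_5 or N (`isResolved_eq_true`).

C_5 and N are isomorphic to their own jump graphs, so a divergent sequence cannot start from either.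
-/

/-! ### Embeddings up to isolated vertices, and monotonicity of the jump graph -/

/-- `G` without its isolated vertices is isomorphic to a subgraph of `H`. -/
def EmbedsIn {V : Type u} {W : Type v} (G : SimpleGraph V) (H : SimpleGraph W) : Prop :=
  ∃ f : V → W, Set.InjOn f G.support ∧ ∀ a b, G.Adj a b → H.Adj (f a) (f b)

theorem EmbedsIn.trans {V : Type u} {W : Type v} {X : Type w} {G : SimpleGraph V}
    {H : SimpleGraph W} {K : SimpleGraph X} (h : EmbedsIn G H) (h' : EmbedsIn H K) :
    EmbedsIn G K := by
  obtain ⟨f, hf, hf'⟩ := h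
  obtain ⟨g, hg, hg'⟩ := h'
  refine ⟨g ∘ f, hg.comp hf ?_, fun a b h => hg' _ _ (hf' _ _ h)⟩
  rintro a ⟨b, hab⟩
  exact ⟨f b, hf' _ _ hab⟩

theorem mem_support_of_mem_edge {V : Type u} {G : SimpleGraph V} (e : G.edgeSet) {v : V}
    (hv : v ∈ (e : Sym2 V)) : v ∈ G.support := by
  obtain ⟨e, he⟩ := e
  obtain ⟨w, rfl⟩ := hv
  exact ⟨w, he⟩

/-- The map on edges induced by an edge-preserving map on vertices. -/
def mapEdge {V : Type u} {W : Type v} {G : SimpleGraph V} {H : SimpleGraph W} (f : V → W)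
    (hf : ∀ a b, G.Adj a b → H.Adj (f a) (f b)) (e : G.edgeSet) : H.edgeSet :=
  ⟨Sym2.map f e, by
    obtain ⟨e, he⟩ := e
    induction e with
    | _ a b => exact hf a b he⟩

theorem mapEdge_injective {V : Type u} {W : Type v} {G : SimpleGraph V} {H : SimpleGraph W}
    (f : V → W) (hf : ∀ a b, G.Adj a b → H.Adj (f a) (f b)) (hi : Set.InjOn f G.support) :
    Function.Injective (mapEdge f hf) := by
  intro e e' h
  have h' : Sym2.map f e = Sym2.map f e' := congrArg Subtype.val h
  apply Subtype.ext
  apply Sym2.ext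
  intro v
  constructor
  · intro hv
    have : f v ∈ Sym2.map f (e' : Sym2 V) := h' ▸ Sym2.mem_map.2 ⟨v, hv, rfl⟩
    obtain ⟨w, hw, hwv⟩ := Sym2.mem_map.1 this
    rwa [← hi (mem_support_of_mem_edge e' hw) (mem_support_of_mem_edge e hv) hwv]
  · intro hv
    have : f v ∈ Sym2.map f (e : Sym2 V) := h'.symm ▸ Sym2.mem_map.2 ⟨v, hv, rfl⟩
    obtain ⟨w, hw, hwv⟩ := Sym2.mem_map.1 this
    rwa [← hi (mem_support_of_mem_edge e hw) (mem_support_of_mem_edge e' hv) hwv]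

/-- Injectivity on the support means that images of edges meet only if the edges do, so even a
non-induced embedding becomes induced after one jump. -/
theorem mapEdge_adj_iff {V : Type u} {W : Type v} {G : SimpleGraph V} {H : SimpleGraph W}
    (f : V → W) (hf : ∀ a b, G.Adj a b → H.Adj (f a) (f b)) (hi : Set.InjOn f G.support)
    (e e' : G.edgeSet) :
    (jump H).Adj (mapEdge f hf e) (mapEdge f hf e') ↔ (jump G).Adj e e' := by
  refine not_congr ⟨?_, ?_⟩
  · rintro ⟨w, h, h'⟩
    obtain ⟨a, ha, rfl⟩ := Sym2.mem_map.1 h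
    obtain ⟨b, hb, hab⟩ := Sym2.mem_map.1 h'
    rw [hi (mem_support_of_mem_edge e' hb) (mem_support_of_mem_edge e ha) hab] at hb
    exact ⟨a, ha, hb⟩
  · rintro ⟨a, h, h'⟩
    exact ⟨f a, Sym2.mem_map.2 ⟨a, h, rfl⟩, Sym2.mem_map.2 ⟨a, h', rfl⟩⟩

theorem EmbedsIn.jump {V : Type u} {W : Type v} {G : SimpleGraph V} {H : SimpleGraph W}
    (h : EmbedsIn G H) : EmbedsIn (jump G) (jump H) := by
  obtain ⟨f, hi, hf⟩ := h
  exact ⟨mapEdge f hf, (mapEdge_injective f hf hi).injOn,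
    fun e e' h => (mapEdge_adj_iff f hf hi e e').2 h⟩

theorem EmbedsIn.iterJump {V : Type u} {W : Type v} {G : SimpleGraph V} {H : SimpleGraph W}
    (h : EmbedsIn G H) : ∀ k, EmbedsIn (iterJump G k).G (iterJump H k).G
  | 0 => h
  | k + 1 => (h.iterJump k).jump

theorem iterJump_iterJump {V : Type u} (G : SimpleGraph V) (k : ℕ) :
    ∀ j, iterJump (iterJump G k).G j = iterJump G (k + j)
  | 0 => rfl
  | j + 1 => by
    change Graph.mk _ (jump (iterJump (iterJump G k).G j).G) =
      Graph.mk _ (jump (iterJump G (k + j)).G)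
    rw [iterJump_iterJump G k j]

theorem finite_iterJump {V : Type u} [Finite V] (G : SimpleGraph V) :
    ∀ k, Finite (iterJump G k).V
  | 0 => ‹Finite V›
  | k + 1 => by
    have := finite_iterJump G k
    exact inferInstanceAs (Finite (iterJump G k).G.edgeSet)

theorem EmbedsIn.ncard_edgeSet_le {V : Type u} {W : Type v} [Finite W] {G : SimpleGraph V}
    {H : SimpleGraph W} (h : EmbedsIn G H) : G.edgeSet.ncard ≤ H.edgeSet.ncard := by
  obtain ⟨f, hi, hf⟩ := h
  exact Nat.card_le_card_of_injective _ (mapEdge_injective f hf hi)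

theorem terminates_of_edge {V : Type u} {G : SimpleGraph V} (k : ℕ)
    (h : ∀ a b, ¬ (iterJump G k).G.Adj a b) : Terminates G := by
  refine ⟨k + 1, ⟨?_⟩⟩
  rintro ⟨e, he⟩
  induction e with
  | _ a b => exact h a b he

theorem Terminates.of_embedsIn {V : Type u} {W : Type v} {G : SimpleGraph V} {H : SimpleGraph W}
    (hH : Terminates H) (h : EmbedsIn G H) : Terminates G := by
  obtain ⟨k, hk⟩ := hH
  obtain ⟨f, -⟩ := h.iterJump k
  exact terminates_of_edge k fun a _ _ => hk.elim (f a)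

theorem Terminates.of_jump {V : Type u} {G : SimpleGraph V} (h : Terminates (jump G)) :
    Terminates G := by
  obtain ⟨k, hk⟩ := h
  exact ⟨1 + k, iterJump_iterJump G 1 k ▸ hk⟩

/-! ### Cores and unbounded growth -/

/-- A finite graph with at least eight vertices, all of degree at least three. -/
def IsCore {W : Type u} (H : SimpleGraph W) : Prop :=
  8 ≤ Nat.card W ∧ ∀ v, 3 ≤ (H.neighborSet v).ncard

/-- With n vertices there are at least 3n/2 > n edges. The degree of the edge xy in the jump graph
is the number of edges avoiding x and y. Each of the other n - 2 vertices keeps a neighbour outside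
{x, y}, so there are at least (n - 2)/2 ≥ 3 such edges; this is where eight comes from. -/
theorem IsCore.jump {W : Type u} {H : SimpleGraph W} (h : IsCore H) :
    IsCore (jump H) ∧ Nat.card W < Nat.card H.edgeSet := by
  classical
  obtain ⟨h8, h3⟩ := h
  have : Finite W := (Nat.card_pos_iff.1 (by omega)).2
  have := Fintype.ofFinite W
  rw [Nat.card_eq_fintype_card] at h8 ⊢
  have hcard : Fintype.card W < Nat.card H.edgeSet := by
    have h1 := H.sum_degrees_eq_twice_card_edges
    have h2 : ∑ _v : W, 3 ≤ ∑ v, H.degree v := Finset.sum_le_sum fun v _ => by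
      rw [← H.card_neighborSet_eq_degree, ← Nat.card_eq_fintype_card]
      exact h3 v
    rw [Finset.sum_const, Finset.card_univ, smul_eq_mul] at h2
    rw [Nat.card_eq_fintype_card, ← SimpleGraph.edgeFinset_card]
    omega
  refine ⟨⟨by omega, ?_⟩, hcard⟩
  rintro ⟨e, he⟩
  induction e with
  | _ x y =>
  have hxy : x ≠ y := H.ne_of_adj he
  let S : Set W := {x, y}ᶜ
  have hS : Fintype.card S = Fintype.card W - 2 := by
    rw [Fintype.card_compl_set, ← Nat.card_eq_fintype_card (α := ({x, y} : Set W)),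
      Nat.card_coe_set_eq, Set.ncard_pair hxy]
  have h1 := (H.induce S).sum_degrees_eq_twice_card_edges
  have h2 : ∑ _v : S, 1 ≤ ∑ v, (H.induce S).degree v := Finset.sum_le_sum fun v _ => by
    have : ({x, y} : Set W).ncard < (H.neighborSet v).ncard := by
      rw [Set.ncard_pair hxy]; exact h3 v
    obtain ⟨z, hz, hz'⟩ := Set.exists_mem_notMem_of_ncard_lt_ncard this
    exact (SimpleGraph.degree_pos_iff_exists_adj _ _).2 ⟨⟨z, hz'⟩, hz⟩
  rw [Finset.sum_const, Finset.card_univ, smul_eq_mul, hS] at h2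
  have h4 : 3 ≤ Nat.card (H.induce S).edgeSet := by
    rw [Nat.card_eq_fintype_card, ← SimpleGraph.edgeFinset_card]
    omega
  refine h4.trans ?_
  have hf : ∀ a b, (H.induce S).Adj a b → H.Adj (a : W) (b : W) := fun _ _ h => h
  have hi := mapEdge_injective Subtype.val hf Subtype.val_injective.injOn
  have hmem : ∀ e, mapEdge Subtype.val hf e ∈
      (JumpGraph.jump H).neighborSet ⟨s(x, y), he⟩ := by
    rintro e ⟨v, hv, hv'⟩
    obtain ⟨⟨a, ha⟩, -, rfl⟩ := Sym2.mem_map.1 hv'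
    exact ha (by simpa using hv)
  exact Nat.card_le_card_of_injective
    (fun e => (⟨_, hmem e⟩ : (JumpGraph.jump H).neighborSet ⟨s(x, y), he⟩))
    fun a b hab => hi (congrArg Subtype.val hab)

theorem IsCore.iterJump {W : Type u} {H : SimpleGraph W} (h : IsCore H) :
    ∀ k, IsCore (iterJump H k).G ∧ k ≤ Nat.card (iterJump H k).V
  | 0 => ⟨h, Nat.zero_le _⟩
  | k + 1 => ⟨(h.iterJump k).1.jump.1, (h.iterJump k).2.trans_lt (h.iterJump k).1.jump.2⟩

/-- Some iterated jump graph contains a core. -/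
def Explodes {V : Type u} (G : SimpleGraph V) : Prop :=
  ∃ (k : ℕ) (W : Type) (H : SimpleGraph W), IsCore H ∧ EmbedsIn H (iterJump G k).G

theorem Explodes.mono {V : Type u} {W : Type v} {G : SimpleGraph V} {H : SimpleGraph W}
    (hG : Explodes G) (h : EmbedsIn G H) : Explodes H := by
  obtain ⟨k, X, K, hK, hKG⟩ := hG
  exact ⟨k, X, K, hK, hKG.trans (h.iterJump k)⟩

theorem Explodes.of_jump {V : Type u} {G : SimpleGraph V} (h : Explodes (jump G)) :
    Explodes G := by
  obtain ⟨k, X, K, hK, hKG⟩ := h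
  exact ⟨1 + k, X, K, hK, iterJump_iterJump G 1 k ▸ hKG⟩

theorem Explodes.tendsto {V : Type u} [Finite V] {G : SimpleGraph V} (h : Explodes G) :
    Filter.Tendsto (fun k => numEdges G k) Filter.atTop Filter.atTop := by
  obtain ⟨k, X, K, hK, hKG⟩ := h
  rw [← Filter.tendsto_add_atTop_iff_nat k]
  refine Filter.tendsto_atTop_mono (fun j => ?_) Filter.tendsto_id
  have := finite_iterJump G (k + j)
  have h1 := (hK.iterJump (j + 1)).2
  have h2 := hKG.iterJump j
  rw [iterJump_iterJump] at h2
  rw [Nat.add_comm j k]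
  -- The edges of the j-th iterate of the core are the vertices of its (j + 1)-st iterate.
  exact (Nat.le_succ j).trans (h1.trans h2.ncard_edgeSet_le)

/-! ### Near-stars terminate -/

/-- All edges but at most one pass through a common vertex. -/
def NearStar {V : Type u} (G : SimpleGraph V) : Prop :=
  ∃ (c : V) (e : Sym2 V), ∀ e' ∈ G.edgeSet, c ∈ e' ∨ e' = e

theorem NearStar.terminates {V : Type u} {G : SimpleGraph V} (h : NearStar G) :
    Terminates G := by
  obtain ⟨c, e, h⟩ := h
  have h1 : ∀ x y, (jump G).Adj x y → (x : Sym2 V) = e ∨ (y : Sym2 V) = e := by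
    intro x y hxy
    by_contra! hne
    exact hxy ⟨c, (h x x.2).resolve_right hne.1, (h y y.2).resolve_right hne.2⟩
  have h2 : ∀ z : (jump G).edgeSet, ∃ x ∈ (z : Sym2 G.edgeSet), (x : Sym2 V) = e := by
    rintro ⟨z, hz⟩
    induction z with
    | _ x y => exact (h1 x y hz).elim (fun h => ⟨x, by simp, h⟩) fun h => ⟨y, by simp, h⟩
  -- Every edge of the jump graph has the exceptional edge `e` as an end, so no two of them are
  -- disjoint and the second jump graph has no edges.
  refine terminates_of_edge 2 fun z z' hzz' => hzz' ?_
  obtain ⟨x, hx, hxe⟩ := h2 z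
  obtain ⟨x', hx', hxe'⟩ := h2 z'
  obtain rfl : x = x' := Subtype.ext (hxe.trans hxe'.symm)
  exact ⟨x, hx, hx'⟩

/-! ### Isomorphisms and the two fixed points -/

theorem isoUpToIsolated_of_embedding {V : Type u} {W : Type v} {G : SimpleGraph V}
    {H : SimpleGraph W} (f : W → V) (hi : Set.InjOn f H.support)
    (hf : ∀ a b, H.Adj a b → G.Adj (f a) (f b))
    (hs : ∀ x y, G.Adj x y → ∃ a b, H.Adj a b ∧ f a = x ∧ f b = y) : IsoUpToIsolated G H := by
  have hm : ∀ a ∈ H.support, f a ∈ G.support := by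
    rintro a ⟨b, hab⟩
    exact ⟨f b, hf _ _ hab⟩
  let g : H.support → G.support := fun a => ⟨f a, hm a a.2⟩
  have hg : Function.Bijective g := by
    refine ⟨fun a b hab => Subtype.ext (hi a.2 b.2 (congrArg Subtype.val hab)), ?_⟩
    rintro ⟨x, y, hxy⟩
    obtain ⟨a, b, hab, rfl, rfl⟩ := hs x y hxy
    exact ⟨⟨a, b, hab⟩, rfl⟩
  refine ⟨SimpleGraph.Iso.symm ⟨Equiv.ofBijective g hg, ?_⟩⟩
  rintro ⟨a, ha⟩ ⟨b, hb⟩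
  refine ⟨fun h => ?_, fun h => hf a b h⟩
  obtain ⟨a', b', hab, ha', hb'⟩ := hs _ _ h
  have h1 : a' = a := hi ⟨b', hab⟩ ha ha'
  have h2 : b' = b := hi ⟨a', hab.symm⟩ hb hb'
  subst h1 h2
  exact hab

theorem jump_iso_of_iso {V : Type u} {W : Type v} {G : SimpleGraph V} {H : SimpleGraph W}
    (φ : G ≃g H) : Nonempty (jump G ≃g jump H) := by
  have hf : ∀ a b, G.Adj a b → H.Adj (φ a) (φ b) := fun a b h => φ.map_adj_iff.2 h
  have hi := mapEdge_injective φ hf φ.injective.injOn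
  refine ⟨⟨Equiv.ofBijective (mapEdge φ hf) ⟨hi, ?_⟩,
    fun {a b} => mapEdge_adj_iff φ hf φ.injective.injOn a b⟩⟩
  rintro ⟨e, he⟩
  induction e with
  | _ x y =>
  refine ⟨⟨s(φ.symm x, φ.symm y), φ.symm.map_adj_iff.2 he⟩, Subtype.ext ?_⟩
  simp [mapEdge]

theorem jump_induce_support_iso {V : Type u} (G : SimpleGraph V) :
    Nonempty (jump (G.induce G.support) ≃g jump G) := by
  have hf : ∀ a b, (G.induce G.support).Adj a b → G.Adj (a : V) (b : V) := fun _ _ h => h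
  have hv : Set.InjOn Subtype.val (G.induce G.support).support := Subtype.val_injective.injOn
  refine ⟨⟨Equiv.ofBijective (mapEdge Subtype.val hf) ⟨mapEdge_injective _ hf hv, ?_⟩,
    fun {a b} => mapEdge_adj_iff _ hf hv a b⟩⟩
  rintro ⟨e, he⟩
  induction e with
  | _ x y => exact ⟨⟨s(⟨x, y, he⟩, ⟨y, x, SimpleGraph.Adj.symm he⟩), he⟩, rfl⟩

theorem converges_of_isoUpToIsolated {V : Type u} {W : Type v} {G : SimpleGraph V}
    {H : SimpleGraph W} (h : IsoUpToIsolated G H) (hH : Nonempty (jump H ≃g H)) :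
    Converges G := by
  obtain ⟨φ⟩ := h
  obtain ⟨a⟩ := jump_induce_support_iso G
  obtain ⟨b⟩ := jump_induce_support_iso H
  obtain ⟨c⟩ := jump_iso_of_iso φ
  obtain ⟨ψ⟩ := hH
  have key : ∀ k, Nonempty ((iterJump G (k + 1)).G ≃g H) := by
    intro k
    induction k with
    | zero => exact ⟨((a.symm.trans c).trans b).trans ψ⟩
    | succ k ih =>
      obtain ⟨χ⟩ := ih
      obtain ⟨χ'⟩ := jump_iso_of_iso χ
      exact ⟨χ'.trans ψ⟩
  -- The index starts at 1 because `G` may have isolated vertices, which the first jump removes.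
  refine ⟨1, iterJump G 1, fun k hk => ?_⟩
  obtain ⟨k, rfl⟩ := Nat.exists_eq_add_of_le' hk
  obtain ⟨x⟩ := key k
  obtain ⟨y⟩ := key 0
  exact ⟨x.trans y.symm⟩

theorem jump_cycleGraph_five_iso :
    Nonempty (jump (SimpleGraph.cycleGraph 5) ≃g SimpleGraph.cycleGraph 5) := by
  -- Stepping by 2 around the cycle makes consecutive values disjoint edges.
  let g : Fin 5 → (SimpleGraph.cycleGraph 5).edgeSet :=
    fun i => ⟨s(2 * i, 2 * i + 1), by revert i; decide⟩
  have hb : Function.Bijective g := by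
    rw [Fintype.bijective_iff_injective_and_card]
    refine ⟨fun i j h => ?_, by decide⟩
    have h' : s(2 * i, 2 * i + 1) = s(2 * j, 2 * j + 1) := congrArg Subtype.val h
    revert i j; decide
  refine ⟨SimpleGraph.Iso.symm ⟨Equiv.ofBijective g hb, ?_⟩⟩
  have : ∀ i j : Fin 5, (¬ ∃ v : Fin 5, v ∈ s(2 * i, 2 * i + 1) ∧ v ∈ s(2 * j, 2 * j + 1)) ↔
      (SimpleGraph.cycleGraph 5).Adj i j := by decide
  exact fun {i j} => this i j

instance : DecidableRel net.Adj := by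
  unfold net; infer_instance

theorem jump_net_iso : Nonempty (jump net ≃g net) := by
  -- Triangle vertices go to their pendant edges, which are pairwise disjoint; each leaf goes to the
  -- triangle edge opposite its neighbour.
  let f : Fin 6 → Sym2 (Fin 6) := ![s(0, 3), s(1, 4), s(2, 5), s(1, 2), s(0, 2), s(0, 1)]
  let g : Fin 6 → net.edgeSet := fun i => ⟨f i, by revert i; decide⟩
  have hb : Function.Bijective g := by
    rw [Fintype.bijective_iff_injective_and_card]
    refine ⟨fun i j h => ?_, by decide⟩
    have h' : f i = f j := congrArg Subtype.val h
    revert i j; decide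
  refine ⟨SimpleGraph.Iso.symm ⟨Equiv.ofBijective g hb, ?_⟩⟩
  have : ∀ i j : Fin 6, (¬ ∃ v : Fin 6, v ∈ f i ∧ v ∈ f j) ↔ net.Adj i j := by decide
  exact fun {i j} => this i j

theorem not_terminates_of_d_eq_top {V : Type u} {G : SimpleGraph V} (h : d G = ⊤) :
    ¬ Terminates G := by
  rintro ⟨k, hk⟩
  have : d G ≤ k := sInf_le ⟨k, rfl, hk⟩
  rw [h] at this
  exact absurd this (by simp)

/-! ### Computing with edge lists -/

/-- The graph on `ℕ` with a given list of edges. -/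
def pat (E : List (ℕ × ℕ)) : SimpleGraph ℕ where
  Adj a b := a ≠ b ∧ ((a, b) ∈ E ∨ (b, a) ∈ E)
  symm := ⟨fun _ _ h => ⟨h.1.symm, h.2.symm⟩⟩
  loopless := ⟨fun _ h => h.1 rfl⟩

/-- Every edge is listed with its smaller endpoint first. -/
def Ascending (E : List (ℕ × ℕ)) : Prop := ∀ e ∈ E, e.1 < e.2

/-- The two edges share no endpoint. -/
def disjointEdges (e f : ℕ × ℕ) : Bool :=
  !(Nat.beq e.1 f.1 || Nat.beq e.1 f.2 || Nat.beq e.2 f.1 || Nat.beq e.2 f.2)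

theorem disjointEdges_iff (e f : ℕ × ℕ) : disjointEdges e f = true ↔
    ¬ ∃ v, v ∈ s(e.1, e.2) ∧ v ∈ s(f.1, f.2) := by
  have hb : ∀ a b : ℕ, Nat.beq a b = false ↔ a ≠ b := fun a b => by
    rw [← Bool.not_eq_true, Nat.beq_eq]
  simp only [disjointEdges, Bool.not_eq_true', Bool.or_eq_false_iff, hb, Sym2.mem_iff]
  constructor
  · rintro ⟨⟨⟨h1, h2⟩, h3⟩, h4⟩ ⟨v, rfl | rfl, h | h⟩ <;> contradiction
  · intro h
    refine ⟨⟨⟨?_, ?_⟩, ?_⟩, ?_⟩ <;> intro h' <;> apply h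
    · exact ⟨e.1, by simp, by simp [h']⟩
    · exact ⟨e.1, by simp, by simp [h']⟩
    · exact ⟨e.2, by simp, by simp [h']⟩
    · exact ⟨e.2, by simp, by simp [h']⟩

/-- The pair with its smaller entry first. -/
def sortPair (x y : ℕ) : ℕ × ℕ := bif Nat.blt x y then (x, y) else (y, x)

/-- The edge list of the jump graph, an edge `(a, b)` being encoded as `Nat.pair a b`. -/
def jumpList : List (ℕ × ℕ) → List (ℕ × ℕ)
  | [] => []
  | e :: E => ((E.filter (disjointEdges e)).map fun f =>
      sortPair (Nat.pair e.1 e.2) (Nat.pair f.1 f.2)) ++ jumpList E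

theorem sortPair_of_lt {x y : ℕ} (h : x < y) : sortPair x y = (x, y) := by
  have : Nat.blt x y = true := by rwa [Nat.blt_eq]
  simp [sortPair, this]

theorem sortPair_of_gt {x y : ℕ} (h : y < x) : sortPair x y = (y, x) := by
  have : Nat.blt x y = false := by
    rw [← Bool.not_eq_true, Nat.blt_eq]; omega
  simp [sortPair, this]

theorem disjointEdges_comm (e f : ℕ × ℕ) : disjointEdges e f = disjointEdges f e := by
  rw [Bool.eq_iff_iff, disjointEdges_iff, disjointEdges_iff]
  simp only [and_comm]

theorem pair_ne_pair {e f : ℕ × ℕ} (h : disjointEdges e f = true) :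
    Nat.pair e.1 e.2 ≠ Nat.pair f.1 f.2 := by
  intro h'
  have := Nat.pair_eq_pair.1 h'
  simp [disjointEdges, this.1] at h

theorem mem_jumpList {E : List (ℕ × ℕ)} {x y : ℕ} : (x, y) ∈ jumpList E ↔
    ∃ e ∈ E, ∃ f ∈ E, disjointEdges e f ∧ x < y ∧ x = Nat.pair e.1 e.2 ∧
      y = Nat.pair f.1 f.2 := by
  induction E with
  | nil => simp [jumpList]
  | cons a E ih =>
    simp only [jumpList, List.mem_append, List.mem_map, List.mem_filter, ih]
    constructor
    · rintro (⟨f, ⟨hf, hd⟩, h⟩ | ⟨e, he, f, hf, h⟩)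
      · rcases (pair_ne_pair hd).lt_or_gt with hlt | hlt
        · rw [sortPair_of_lt hlt] at h
          cases h
          exact ⟨a, by simp, f, by simp [hf], hd, hlt, rfl, rfl⟩
        · rw [sortPair_of_gt hlt] at h
          cases h
          exact ⟨f, by simp [hf], a, by simp, disjointEdges_comm a f ▸ hd, hlt, rfl, rfl⟩
      · exact ⟨e, by simp [he], f, by simp [hf], h⟩
    · rintro ⟨e, he, f, hf, hd, hlt, rfl, rfl⟩
      rcases List.mem_cons.1 he with rfl | he'
      · rcases List.mem_cons.1 hf with rfl | hf'
        · exact absurd hlt (lt_irrefl _)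
        · exact Or.inl ⟨f, ⟨hf', hd⟩, sortPair_of_lt hlt⟩
      · rcases List.mem_cons.1 hf with rfl | hf'
        · exact Or.inl ⟨e, ⟨he', disjointEdges_comm e f ▸ hd⟩, sortPair_of_gt hlt⟩
        · exact Or.inr ⟨e, he', f, hf', hd, hlt, rfl, rfl⟩

theorem ascending_jumpList (E : List (ℕ × ℕ)) : Ascending (jumpList E) := by
  rintro ⟨x, y⟩ h
  obtain ⟨_, _, _, _, _, h, _⟩ := mem_jumpList.1 h
  exact h

theorem sortPair_eq_iff {x y z w : ℕ} :
    sortPair x y = sortPair z w ↔ (x = z ∧ y = w) ∨ (x = w ∧ y = z) := by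
  have h : ∀ x y, s((sortPair x y).1, (sortPair x y).2) = s(x, y) := by
    intro x y
    unfold sortPair
    cases Nat.blt x y
    · exact Sym2.eq_swap
    · rfl
  rw [← Sym2.eq_iff]
  refine ⟨fun h' => by rw [← h x y, ← h z w, h'], fun h' => ?_⟩
  rcases Sym2.eq_iff.1 h' with ⟨rfl, rfl⟩ | ⟨rfl, rfl⟩
  · rfl
  · rcases lt_trichotomy x y with hlt | rfl | hlt
    · rw [sortPair_of_lt hlt, sortPair_of_gt hlt]
    · rfl
    · rw [sortPair_of_lt hlt, sortPair_of_gt hlt]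

/-- Needed because cores are recognised by counting list entries. -/
theorem nodup_jumpList {E : List (ℕ × ℕ)} (hE : E.Nodup) : (jumpList E).Nodup := by
  have hpair : ∀ {e f : ℕ × ℕ}, Nat.pair e.1 e.2 = Nat.pair f.1 f.2 → e = f := fun h =>
    Prod.ext (Nat.pair_eq_pair.1 h).1 (Nat.pair_eq_pair.1 h).2
  induction E with
  | nil => exact List.nodup_nil
  | cons a E ih =>
    obtain ⟨ha, hE⟩ := List.nodup_cons.1 hE
    refine ((hE.filter _).map ?_).append (ih hE) ?_
    · intro f f' h
      rcases sortPair_eq_iff.1 h with h | h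
      · exact hpair h.2
      · exact hpair (h.2.trans h.1)
    · rintro ⟨x, y⟩ hx hx'
      obtain ⟨f, -, h⟩ := List.mem_map.1 hx
      obtain ⟨e, he, e', he', -, hlt, rfl, rfl⟩ := mem_jumpList.1 hx'
      rw [← sortPair_of_lt hlt] at h
      rcases sortPair_eq_iff.1 h with h | h
      · exact ha (hpair h.1 ▸ he)
      · exact ha (hpair h.1 ▸ he')

theorem Ascending.pat_adj {E : List (ℕ × ℕ)} (hE : Ascending E) {a b : ℕ} :
    (pat E).Adj a b ↔ (a, b) ∈ E ∨ (b, a) ∈ E :=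
  ⟨fun h => h.2, fun h => ⟨by
    rcases h with h | h
    · exact (hE _ h).ne
    · exact (hE _ h).ne', h⟩⟩

/-- This direction carries explosion from the computed list back to the graph; `jump_pat_embedsIn`
does so for termination. Ascending order gives each edge a single code. -/
theorem embedsIn_jump_pat {E : List (ℕ × ℕ)} (hE : Ascending E) (hne : E ≠ []) :
    EmbedsIn (pat (jumpList E)) (jump (pat E)) := by
  classical
  obtain ⟨e₀, he₀⟩ := List.exists_mem_of_ne_nil E hne
  have hmem : ∀ e ∈ E, s(e.1, e.2) ∈ (pat E).edgeSet := fun e he => hE.pat_adj.2 (Or.inl he)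
  -- Numbers that encode no listed edge get the default `e₀`, hence the need for `E` to be nonempty.
  let f : ℕ → (pat E).edgeSet := fun n =>
    if h : n.unpair ∈ E then ⟨s(n.unpair.1, n.unpair.2), hmem _ h⟩
    else ⟨s(e₀.1, e₀.2), hmem _ he₀⟩
  have hf : ∀ e (he : e ∈ E), f (Nat.pair e.1 e.2) = ⟨s(e.1, e.2), hmem e he⟩ := by
    intro e he
    have : (Nat.pair e.1 e.2).unpair = e := Nat.unpair_pair _ _
    simp only [f, this, he, dif_pos]
  have hs : ∀ n ∈ (pat (jumpList E)).support, ∃ e ∈ E, n = Nat.pair e.1 e.2 := by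
    rintro n ⟨m, -, h | h⟩ <;> obtain ⟨e, he, e', he', -, -, h, h'⟩ := mem_jumpList.1 h
    · exact ⟨e, he, h⟩
    · exact ⟨e', he', h'⟩
  refine ⟨f, ?_, ?_⟩
  · intro n hn m hm hnm
    obtain ⟨e, he, rfl⟩ := hs n hn
    obtain ⟨e', he', rfl⟩ := hs m hm
    rw [hf e he, hf e' he', Subtype.mk.injEq, Sym2.eq_iff] at hnm
    have h1 := hE e he
    have h2 := hE e' he'
    rcases hnm with ⟨h, h'⟩ | ⟨h, h'⟩
    · rw [h, h']
    · omega
  · have key : ∀ n m, (n, m) ∈ jumpList E → (jump (pat E)).Adj (f n) (f m) := by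
      intro n m h
      obtain ⟨e, he, e', he', hd, -, rfl, rfl⟩ := mem_jumpList.1 h
      rw [hf e he, hf e' he']
      exact (disjointEdges_iff e e').1 hd
    rintro n m ⟨-, h | h⟩
    · exact key n m h
    · exact (key m n h).symm

theorem jump_pat_embedsIn {E : List (ℕ × ℕ)} (hE : Ascending E) :
    EmbedsIn (jump (pat E)) (pat (jumpList E)) := by
  have hex : ∀ x : (pat E).edgeSet, ∃ e ∈ E, (x : Sym2 ℕ) = s(e.1, e.2) := by
    rintro ⟨x, hx⟩
    induction x with
    | _ a b =>
    rcases hE.pat_adj.1 hx with h | h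
    · exact ⟨_, h, rfl⟩
    · exact ⟨_, h, Sym2.eq_swap⟩
  choose g hg hg' using hex
  refine ⟨fun x => Nat.pair (g x).1 (g x).2, ?_, ?_⟩
  · intro x _ y _ hxy
    have := Nat.pair_eq_pair.1 hxy
    exact Subtype.ext (by rw [hg' x, hg' y, this.1, this.2])
  · intro x y hxy
    have hd : disjointEdges (g x) (g y) = true := by
      rw [disjointEdges_iff, ← hg' x, ← hg' y]; exact hxy
    have hd' : disjointEdges (g y) (g x) = true := by
      rw [disjointEdges_iff, ← hg' x, ← hg' y]; exact hxy.symm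
    have hne := pair_ne_pair hd
    refine ⟨hne, ?_⟩
    rcases hne.lt_or_gt with h | h
    · exact Or.inl (mem_jumpList.2 ⟨_, hg x, _, hg y, hd, h, rfl, rfl⟩)
    · exact Or.inr (mem_jumpList.2 ⟨_, hg y, _, hg x, hd', h, rfl, rfl⟩)

/-! ### Checks for explosion, termination and embedding -/

/-- The endpoints of the listed edges. -/
def verts (E : List (ℕ × ℕ)) : List ℕ := (E.map Prod.fst ++ E.map Prod.snd).dedup

theorem mem_verts {E : List (ℕ × ℕ)} (hE : Ascending E) {a : ℕ} :
    a ∈ verts E ↔ a ∈ (pat E).support := by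
  simp only [verts, List.mem_dedup, List.mem_append, List.mem_map, SimpleGraph.mem_support,
    hE.pat_adj]
  constructor
  · rintro (⟨⟨x, y⟩, h, rfl⟩ | ⟨⟨x, y⟩, h, rfl⟩)
    · exact ⟨y, Or.inl h⟩
    · exact ⟨x, Or.inr h⟩
  · rintro ⟨b, h | h⟩
    · exact Or.inl ⟨_, h, rfl⟩
    · exact Or.inr ⟨_, h, rfl⟩

/-- The listed edges that are disjoint from at least three listed edges. -/
def wellSpread (E : List (ℕ × ℕ)) : List (ℕ × ℕ) :=
  E.filter fun e => Nat.ble 3 (E.countP (disjointEdges e))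

/-- The listed edges are the vertices of a core of the jump graph. -/
def isCore (E : List (ℕ × ℕ)) : Bool :=
  Nat.ble 8 E.length && E.all fun e => Nat.ble 3 (E.countP (disjointEdges e))

theorem explodes_of_isCore {E : List (ℕ × ℕ)} (hE : Ascending E) (hn : E.Nodup)
    (h : isCore E) : Explodes (pat E) := by
  simp only [isCore, Bool.and_eq_true, Nat.ble_eq, List.all_eq_true] at h
  let H : SimpleGraph E.toFinset :=
    { Adj := fun e f => disjointEdges e f = true
      symm := ⟨fun e f h => by
        rw [disjointEdges_iff] at h ⊢
        simpa only [and_comm] using h⟩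
      loopless := ⟨fun e h => by simp [disjointEdges] at h⟩ }
  have hmem : ∀ e : E.toFinset, s(e.1.1, e.1.2) ∈ (pat E).edgeSet := fun e =>
    hE.pat_adj.2 (Or.inl (List.mem_toFinset.1 e.2))
  -- The core has listed edges as vertices, so it lies in the jump graph of `pat E`.
  refine Explodes.of_jump ⟨0, E.toFinset, H, ⟨?_, ?_⟩, fun e => ⟨_, hmem e⟩, ?_, ?_⟩
  · rw [Nat.card_eq_fintype_card, Fintype.card_coe, List.toFinset_card_of_nodup hn]
    exact h.1
  · rintro ⟨e, he⟩
    have h1 := h.2 e (List.mem_toFinset.1 he)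
    have : ((E.filter (disjointEdges e)).toFinset : Set (ℕ × ℕ)) =
        Subtype.val '' H.neighborSet ⟨e, he⟩ := by
      ext f
      simp only [List.coe_toFinset, Set.mem_ofPred_eq, List.mem_filter, Set.mem_image]
      constructor
      · intro hf
        exact ⟨⟨f, List.mem_toFinset.2 hf.1⟩, hf.2, rfl⟩
      · rintro ⟨f, hf, rfl⟩
        exact ⟨List.mem_toFinset.1 f.2, hf⟩
    rw [← Set.ncard_image_of_injective _ Subtype.val_injective, ← this, Set.ncard_coe_finset,
      List.toFinset_card_of_nodup (hn.filter _), ← List.countP_eq_length_filter]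
    exact h1
  · rintro ⟨e, he⟩ - ⟨f, hf⟩ - hef
    have h1 := hE e (List.mem_toFinset.1 he)
    have h2 := hE f (List.mem_toFinset.1 hf)
    have hef := congrArg Subtype.val hef
    simp only [Sym2.eq_iff] at hef
    refine Subtype.ext (Prod.ext ?_ ?_) <;> simp only <;> omega
  · exact fun e f hef => (disjointEdges_iff _ _).1 hef

theorem pat_embedsIn_of_subset {E F : List (ℕ × ℕ)} (h : E ⊆ F) : EmbedsIn (pat E) (pat F) :=
  ⟨id, Set.injOn_id _, fun _ _ hab => ⟨hab.1, hab.2.imp (@h _) (@h _)⟩⟩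

/-- One of the first iterated jump graphs visibly contains a core. -/
def explodesList : ℕ → List (ℕ × ℕ) → Bool
  | 0, _ => false
  | n + 1, E => (Nat.ble 8 E.length && isCore (wellSpread E)) || (!E.isEmpty && explodesList n (jumpList E))

theorem explodes_of_explodesList : ∀ n {E : List (ℕ × ℕ)}, Ascending E → E.Nodup →
    explodesList n E → Explodes (pat E) := by
  intro n
  induction n with
  | zero => exact fun _ _ h => absurd h (by simp [explodesList])
  | succ n ih =>
    intro E hE hn h
    rw [explodesList, Bool.or_eq_true] at h
    rcases h with h | h
    · have hs : wellSpread E ⊆ E := List.filter_subset_self _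
      exact (explodes_of_isCore (fun e he => hE e (hs he)) (hn.filter _)
        ((Bool.and_eq_true _ _).mp h).2).mono
        (pat_embedsIn_of_subset hs)
    · obtain ⟨hne, h⟩ := (Bool.and_eq_true _ _).mp h
      exact ((ih (ascending_jumpList E) (nodup_jumpList hn) h).mono
        (embedsIn_jump_pat hE (by rintro rfl; simp at hne))).of_jump

/-- One of the first `n` iterated jump graphs has no edges. -/
def terminatesList : ℕ → List (ℕ × ℕ) → Bool
  | 0, E => E.isEmpty
  | n + 1, E => E.isEmpty || terminatesList n (jumpList E)

theorem terminates_of_terminatesList : ∀ n {E : List (ℕ × ℕ)}, Ascending E →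
    terminatesList n E → Terminates (pat E) := by
  have base : ∀ {E : List (ℕ × ℕ)}, E.isEmpty = true → Terminates (pat E) := by
    intro E h
    rw [List.isEmpty_iff] at h
    subst h
    exact terminates_of_edge 0 fun a b h => by simpa using h.2
  intro n
  induction n with
  | zero => exact fun _ h => base h
  | succ n ih =>
    intro E hE h
    rw [terminatesList, Bool.or_eq_true] at h
    rcases h with h | h
    · exact base h
    · exact ((ih (ascending_jumpList E) h).of_embedsIn (jump_pat_embedsIn hE)).of_jump

/-- Extend a partial assignment of vertices to one that maps the listed edges into `F`. -/
def searchEmbedding : List (ℕ × ℕ) → List (ℕ × ℕ) → List (ℕ × ℕ) → Option (List (ℕ × ℕ))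
  | [], _, s => some s
  | (a, b) :: E, F, s => (F ++ F.map Prod.swap).findSome? fun e =>
      if s.all (fun p => ((p.1 == a) == (p.2 == e.1)) && ((p.1 == b) == (p.2 == e.2)))
      then searchEmbedding E F ((a, e.1) :: (b, e.2) :: s) else none

/-- The map given by an assignment embeds the list `E` in the list `F`. -/
def isEmbedding (s E F : List (ℕ × ℕ)) : Bool :=
  (E.all fun e => F.contains ((s.lookup e.1).getD 0, (s.lookup e.2).getD 0) ||
    F.contains ((s.lookup e.2).getD 0, (s.lookup e.1).getD 0)) &&
  (verts E).all fun a => (verts E).all fun b =>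
    !((s.lookup a).getD 0 == (s.lookup b).getD 0) || a == b

/-- The search finds an embedding of the list `E` in the list `F`. -/
def embedsList (E F : List (ℕ × ℕ)) : Bool :=
  match searchEmbedding E F [] with
  | some s => isEmbedding s E F
  | none => false

/-- The search itself needs no correctness proof, since `isEmbedding` rechecks its output, including
the default value 0. -/
theorem embedsIn_of_embedsList {E F : List (ℕ × ℕ)} (hE : Ascending E) (hF : Ascending F)
    (h : embedsList E F) : EmbedsIn (pat E) (pat F) := by
  unfold embedsList at h
  split at h
  case h_2 => simp at h
  case h_1 s _ =>
    simp only [isEmbedding, Bool.and_eq_true, List.all_eq_true, Bool.or_eq_true,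
      List.contains_iff_mem, Bool.not_eq_true', beq_eq_false_iff_ne, beq_iff_eq] at h
    refine ⟨fun a => (s.lookup a).getD 0, ?_, ?_⟩
    · intro a ha b hb hab
      exact (h.2 a ((mem_verts hE).2 ha) b ((mem_verts hE).2 hb)).resolve_left fun h => h hab
    · rintro a b ⟨-, hab | hab⟩
      · exact hF.pat_adj.2 (h.1 _ hab)
      · exact hF.pat_adj.2 (h.1 _ hab).symm

/-! ### The finite family of patterns -/

/-- A listed vertex that lies on all listed edges but at most one. -/
def centre (E : List (ℕ × ℕ)) : Option ℕ :=
  (verts E).find? fun c => Nat.ble (E.countP fun e => !(e.1 == c || e.2 == c)) 1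

/-- The edge may be added to the list, which has to be done off its centre if there is one. -/
def allowed (E : List (ℕ × ℕ)) (e : ℕ × ℕ) : Bool :=
  !E.contains e && match centre E with
    | none => true
    | some c => !(e.1 == c || e.2 == c)

/-- The edges on two of the vertices `0, …, n - 1`, or on one of them and `n + 1`, or on
`n` and `n + 1`. -/
def newEdges (n : ℕ) : List (ℕ × ℕ) :=
  (List.range n).flatMap (fun b => (List.range b).map fun a => (a, b)) ++
    (List.range (n + 1)).map fun a => (a, n + 1)

/-- A number larger than all vertices. -/
def bound (E : List (ℕ × ℕ)) : ℕ := (E.map fun e => e.2 + 1).foldr max 0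

/-- The edges of the five-cycle. -/
def c5List : List (ℕ × ℕ) := [(0, 1), (1, 2), (2, 3), (3, 4), (0, 4)]

/-- The edges of the net. -/
def netList : List (ℕ × ℕ) := [(0, 1), (1, 2), (0, 2), (0, 3), (1, 4), (2, 5)]

/-- Edge lists reached by adding edges to a single edge, off the centre if there is one, as long
as the graph does not explode. -/
def patterns : List (List (ℕ × ℕ)) :=
  [[(0, 1)],
   [(0, 1), (1, 2)],
   [(0, 1), (2, 3)],
   [(0, 1), (1, 2), (1, 3)],
   [(0, 1), (1, 2), (2, 3)],
   [(0, 1), (1, 2), (3, 4)],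
   [(0, 1), (2, 3), (4, 5)],
   [(0, 1), (1, 2), (1, 3), (0, 2)],
   [(0, 1), (1, 2), (1, 3), (0, 4)],
   [(0, 1), (1, 2), (1, 3), (4, 5)],
   [(0, 1), (1, 2), (2, 3), (0, 3)],
   [(0, 1), (1, 2), (2, 3), (0, 4)],
   [(0, 1), (1, 2), (2, 3), (4, 5)],
   [(0, 1), (1, 2), (3, 4), (0, 2)],
   [(0, 1), (1, 2), (3, 4), (3, 5)],
   [(0, 1), (1, 2), (3, 4), (5, 6)],
   [(0, 1), (2, 3), (4, 5), (6, 7)],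
   [(0, 1), (1, 2), (1, 3), (0, 2), (0, 3)],
   [(0, 1), (1, 2), (1, 3), (0, 2), (0, 4)],
   [(0, 1), (1, 2), (1, 3), (0, 2), (3, 4)],
   [(0, 1), (1, 2), (1, 3), (0, 2), (4, 5)],
   [(0, 1), (1, 2), (1, 3), (0, 4), (0, 5)],
   [(0, 1), (1, 2), (1, 3), (0, 4), (2, 4)],
   [(0, 1), (1, 2), (1, 3), (0, 4), (2, 5)],
   [(0, 1), (1, 2), (1, 3), (0, 4), (4, 5)],
   [(0, 1), (1, 2), (1, 3), (0, 4), (5, 6)],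
   [(0, 1), (1, 2), (2, 3), (0, 3), (4, 5)],
   [(0, 1), (1, 2), (2, 3), (3, 4), (0, 4)],
   [(0, 1), (1, 2), (1, 3), (0, 2), (0, 3), (0, 4)],
   [(0, 1), (1, 2), (1, 3), (0, 2), (0, 3), (2, 3)],
   [(0, 1), (1, 2), (1, 3), (0, 2), (0, 3), (2, 4)],
   [(0, 1), (1, 2), (1, 3), (0, 2), (0, 4), (0, 5)],
   [(0, 1), (1, 2), (0, 2), (0, 3), (1, 4), (2, 5)],
   [(0, 1), (1, 2), (1, 3), (0, 2), (3, 4), (1, 4)],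
   [(0, 1), (1, 2), (1, 3), (0, 2), (3, 4), (1, 5)]]

/-- Every allowed extension of a pattern explodes or is again a pattern. -/
def isClosed : Bool :=
  patterns.all fun E => (newEdges (bound E)).all fun e =>
    !allowed E e || explodesList 5 (e :: E) ||
      patterns.any fun F => F.length == E.length + 1 &&
        (jumpList F).length == (jumpList (e :: E)).length && embedsList F (e :: E)

/-- The patterns without centre terminate, or are the five-cycle or the net. -/
def isResolved : Bool :=
  patterns.all fun E => (centre E).isSome || terminatesList 7 E || E == c5List || E == netList

theorem isResolved_eq_true : isResolved = true := by decide +kernel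

theorem isClosed_eq_true : isClosed = true := by decide +kernel

/-! ### Extending an embedded pattern by an edge -/

theorem lt_bound {E : List (ℕ × ℕ)} {e : ℕ × ℕ} (he : e ∈ E) : e.2 < bound E := by
  induction E with
  | nil => simp at he
  | cons x E ih =>
    have h : bound (x :: E) = max (x.2 + 1) (bound E) := rfl
    rw [h]
    rcases List.mem_cons.1 he with rfl | he
    · omega
    · have := ih he
      omega

theorem lt_bound_of_mem_support {E : List (ℕ × ℕ)} (hE : Ascending E) {a : ℕ}
    (ha : a ∈ (pat E).support) : a < bound E := by
  obtain ⟨b, -, h | h⟩ := ha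
  · exact (hE _ h).trans (lt_bound h)
  · exact lt_bound h

theorem embedsIn_cons {V : Type u} {G : SimpleGraph V} {E : List (ℕ × ℕ)} {a b : ℕ} {f : ℕ → V}
    (hi : Set.InjOn f ((pat E).support ∪ {a, b})) (hf : ∀ i j, (pat E).Adj i j → G.Adj (f i) (f j))
    (hab : G.Adj (f a) (f b)) : EmbedsIn (pat ((a, b) :: E)) G := by
  have key : ∀ i j, (pat ((a, b) :: E)).Adj i j →
      (pat E).Adj i j ∨ (i = a ∧ j = b) ∨ (i = b ∧ j = a) := by
    rintro i j ⟨hne, h⟩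
    simp only [List.mem_cons, Prod.mk.injEq] at h
    rcases h with (h | h) | (h | h)
    · exact Or.inr (Or.inl h)
    · exact Or.inl ⟨hne, Or.inl h⟩
    · exact Or.inr (Or.inr h.symm)
    · exact Or.inl ⟨hne, Or.inr h⟩
  refine ⟨f, hi.mono ?_, ?_⟩
  · rintro i ⟨j, hij⟩
    rcases key i j hij with h | ⟨rfl, -⟩ | ⟨rfl, -⟩
    · exact Or.inl ⟨j, h⟩
    · exact Or.inr (by simp)
    · exact Or.inr (by simp)
  · intro i j hij
    rcases key i j hij with h | ⟨rfl, rfl⟩ | ⟨rfl, rfl⟩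
    · exact hf i j h
    · exact hab
    · exact hab.symm

theorem mem_newEdges {n a b : ℕ} :
    (a, b) ∈ newEdges n ↔ (a < b ∧ b < n) ∨ (a ≤ n ∧ b = n + 1) := by
  simp only [newEdges, List.mem_append, List.mem_flatMap, List.mem_range, List.mem_map,
    Prod.mk.injEq]
  constructor
  · rintro (⟨b', hb, a', ha, rfl, rfl⟩ | ⟨a', ha, rfl, rfl⟩)
    · exact Or.inl ⟨ha, hb⟩
    · exact Or.inr ⟨by omega, rfl⟩
  · rintro (⟨h, h'⟩ | ⟨h, rfl⟩)
    · exact Or.inl ⟨b, h', a, h, rfl, rfl⟩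
    · exact Or.inr ⟨a, by omega, rfl, rfl⟩

/-- The label of a new edge depends on which of its ends are already covered: two old labels, an old
label and `n + 1`, or `n` and `n + 1`. The hypothesis `hor` excludes only the case that reduces to
these by swapping `x` and `y`. The last conclusion keeps the new edge off the centre. -/
theorem exists_extension_aux {V : Type u} {G : SimpleGraph V} {E : List (ℕ × ℕ)} {n : ℕ}
    {f : ℕ → V} (hE : Ascending E) (hn : ∀ a ∈ (pat E).support, a < n)
    (hi : Set.InjOn f (pat E).support) (hf : ∀ i j, (pat E).Adj i j → G.Adj (f i) (f j))
    {x y : V} (hxy : G.Adj x y) (hnew : ¬ ∃ a b, (pat E).Adj a b ∧ f a = x ∧ f b = y)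
    (hor : x ∈ f '' (pat E).support ∨ y ∉ f '' (pat E).support) :
    ∃ e ∈ newEdges n, e.1 < e.2 ∧ e ∉ E ∧ EmbedsIn (pat (e :: E)) G ∧
      ∀ c < n, f c ≠ x → f c ≠ y → e.1 ≠ c ∧ e.2 ≠ c := by
  by_cases hx : x ∈ f '' (pat E).support
  · obtain ⟨a, ha, rfl⟩ := hx
    by_cases hy : y ∈ f '' (pat E).support
    · obtain ⟨b, hb, rfl⟩ := hy
      have hne : a ≠ b := by rintro rfl; exact G.irrefl hxy
      have hnot : ¬ (pat E).Adj a b := fun h => hnew ⟨a, b, h, rfl, rfl⟩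
      rw [hE.pat_adj] at hnot
      push Not at hnot
      have hs : ((pat E).support ∪ {a, b} : Set ℕ) ⊆ (pat E).support := by
        rintro c (hc | rfl | rfl) <;> assumption
      have hs' : ((pat E).support ∪ {b, a} : Set ℕ) ⊆ (pat E).support := by
        rintro c (hc | rfl | rfl) <;> assumption
      rcases hne.lt_or_gt with h | h
      · refine ⟨(a, b), mem_newEdges.2 (Or.inl ⟨h, hn b hb⟩), h, hnot.1,
          embedsIn_cons (hi.mono hs) hf hxy, fun c _ h1 h2 => ⟨?_, ?_⟩⟩
        · rintro rfl; exact h1 rfl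
        · rintro rfl; exact h2 rfl
      · refine ⟨(b, a), mem_newEdges.2 (Or.inl ⟨h, hn a ha⟩), h, hnot.2,
          embedsIn_cons (hi.mono hs') hf hxy.symm, fun c _ h1 h2 => ⟨?_, ?_⟩⟩
        · rintro rfl; exact h2 rfl
        · rintro rfl; exact h1 rfl
    · have hlt : ∀ c ∈ (pat E).support, c ≠ n + 1 := fun c hc => by
        have := hn c hc; omega
      have hup : ∀ c ∈ (pat E).support, Function.update f (n + 1) y c = f c := fun c hc =>
        Function.update_of_ne (hlt c hc) _ _
      have han : a < n := hn a ha
      refine ⟨(a, n + 1), mem_newEdges.2 (Or.inr ⟨han.le, rfl⟩), by simp only; omega, ?_,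
        embedsIn_cons (f := Function.update f (n + 1) y) ?_ ?_ ?_, fun c hc h1 h2 => ⟨?_, ?_⟩⟩
      · intro h
        exact hlt (n + 1) ⟨a, hE.pat_adj.2 (Or.inr h)⟩ rfl
      · have : ((pat E).support ∪ {a, n + 1} : Set ℕ) = insert (n + 1) (pat E).support := by
          ext c
          simp only [Set.mem_union, Set.mem_insert_iff, Set.mem_singleton_iff]
          constructor
          · rintro (h | rfl | h)
            · exact Or.inr h
            · exact Or.inr ha
            · exact Or.inl h
          · rintro (h | h)
            · exact Or.inr (Or.inr h)
            · exact Or.inl h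
        rw [this, Set.injOn_insert fun h => hlt _ h rfl]
        refine ⟨hi.congr fun c hc => (hup c hc).symm, ?_⟩
        rw [Function.update_self, Set.image_congr hup]
        exact hy
      · intro i j hij
        rw [hup i ⟨j, hij⟩, hup j ⟨i, hij.symm⟩]
        exact hf i j hij
      · rw [Function.update_self, hup a ha]
        exact hxy
      · rintro rfl; exact h1 rfl
      · simp only; omega
  · have hy := hor.resolve_left hx
    let g := Function.update (Function.update f n x) (n + 1) y
    have hg1 : g (n + 1) = y := Function.update_self _ _ _
    have hg0 : g n = x := by
      simp only [g]
      rw [Function.update_of_ne (by omega), Function.update_self]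
    have hup : ∀ c ∈ (pat E).support, g c = f c := fun c hc => by
      have := hn c hc
      simp only [g]
      rw [Function.update_of_ne (by omega), Function.update_of_ne (by omega)]
    refine ⟨(n, n + 1), mem_newEdges.2 (Or.inr ⟨le_rfl, rfl⟩), by simp, ?_,
        embedsIn_cons (f := g) ?_ ?_ ?_, fun c hc h1 h2 => ⟨?_, ?_⟩⟩
    · intro h
      have := hn n ⟨n + 1, hE.pat_adj.2 (Or.inl h)⟩
      omega
    · have : ((pat E).support ∪ {n, n + 1} : Set ℕ) = insert (n + 1) (insert n (pat E).support) := by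
        ext c
        simp only [Set.mem_union, Set.mem_insert_iff, Set.mem_singleton_iff]
        tauto
      have h0 : n ∉ (pat E).support := fun h => (hn n h).false
      have h1 : n + 1 ∉ insert n (pat E).support := by
        rintro (h | h)
        · omega
        · have := hn _ h; omega
      rw [this, Set.injOn_insert h1, Set.injOn_insert h0, Set.image_insert_eq, hg1, hg0,
        Set.image_congr hup]
      refine ⟨⟨hi.congr fun c hc => (hup c hc).symm, hx⟩, ?_⟩
      rintro (h | h)
      · exact hxy.ne h.symm
      · exact hy h
    · intro i j hij
      rw [hup i ⟨j, hij⟩, hup j ⟨i, hij.symm⟩]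
      exact hf i j hij
    · rw [hg0, hg1]
      exact hxy
    · simp only; omega
    · simp only; omega

theorem exists_extension {V : Type u} {G : SimpleGraph V} {E : List (ℕ × ℕ)} {n : ℕ}
    {f : ℕ → V} (hE : Ascending E) (hn : ∀ a ∈ (pat E).support, a < n)
    (hi : Set.InjOn f (pat E).support) (hf : ∀ i j, (pat E).Adj i j → G.Adj (f i) (f j))
    {x y : V} (hxy : G.Adj x y) (hnew : ¬ ∃ a b, (pat E).Adj a b ∧ f a = x ∧ f b = y) :
    ∃ e ∈ newEdges n, e.1 < e.2 ∧ e ∉ E ∧ EmbedsIn (pat (e :: E)) G ∧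
      ∀ c < n, f c ≠ x → f c ≠ y → e.1 ≠ c ∧ e.2 ≠ c := by
  by_cases h : x ∈ f '' (pat E).support ∨ y ∉ f '' (pat E).support
  · exact exists_extension_aux hE hn hi hf hxy hnew h
  · push Not at h
    obtain ⟨e, he, hlt, hmem, hemb, hc⟩ := exists_extension_aux hE hn hi hf hxy.symm
      (fun ⟨a, b, hab, ha, hb⟩ => hnew ⟨b, a, hab.symm, hb, ha⟩) (Or.inl h.2)
    exact ⟨e, he, hlt, hmem, hemb, fun c hcn h1 h2 => hc c hcn h2 h1⟩

theorem patterns_wellFormed : ∀ E ∈ patterns, Ascending E ∧ E.Nodup := by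
  unfold Ascending
  decide +kernel

theorem exists_pattern_of_extension {E : List (ℕ × ℕ)} (hE : E ∈ patterns) {e : ℕ × ℕ}
    (he : e ∈ newEdges (bound E)) (hlt : e.1 < e.2) (hmem : e ∉ E)
    (hc : ∀ c, centre E = some c → e.1 ≠ c ∧ e.2 ≠ c) :
    Explodes (pat (e :: E)) ∨
      ∃ F ∈ patterns, F.length = E.length + 1 ∧ EmbedsIn (pat F) (pat (e :: E)) := by
  obtain ⟨hasc, hnd⟩ := patterns_wellFormed E hE
  have hasc' : Ascending (e :: E) := by
    intro e' he'
    rcases List.mem_cons.1 he' with rfl | h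
    · exact hlt
    · exact hasc _ h
  have hallowed : allowed E e = true := by
    unfold allowed
    rw [Bool.and_eq_true]
    refine ⟨by simpa using hmem, ?_⟩
    cases h : centre E with
    | none => rfl
    | some c => simpa using hc c h
  have h := isClosed_eq_true
  simp only [isClosed, List.all_eq_true] at h
  have h := h E hE e he
  rw [Bool.or_eq_true, Bool.or_eq_true, hallowed] at h
  rcases h with (h | h) | h
  · simp at h
  · exact Or.inl (explodes_of_explodesList _ hasc' (List.nodup_cons.2 ⟨hmem, hnd⟩) h)
  · simp only [List.any_eq_true, Bool.and_eq_true, beq_iff_eq] at h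
    -- The discarded equality of numbers of disjoint edge pairs only spares hopeless embedding
    -- searches.
    obtain ⟨F, hF, ⟨hl, -⟩, hemb⟩ := h
    exact Or.inr ⟨F, hF, hl, embedsIn_of_embedsList (patterns_wellFormed F hF).1 hasc' hemb⟩

/-! ### Maximal patterns determine the graph -/

/-- Edges of `G` off `f c` come from listed edges off `c`, of which there is at most one. -/
theorem nearStar_of_centre {V : Type u} {G : SimpleGraph V} {E : List (ℕ × ℕ)} {c : ℕ} {f : ℕ → V}
    (hc : centre E = some c)
    (h : ∀ x y, G.Adj x y → f c ≠ x → f c ≠ y → ∃ a b, (pat E).Adj a b ∧ f a = x ∧ f b = y) :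
    NearStar G := by
  have h1 := List.find?_some hc
  rw [Nat.ble_eq, List.countP_eq_length_filter] at h1
  set L := E.filter fun e => !(e.1 == c || e.2 == c) with hL
  have hLmem : ∀ e, e ∈ L ↔ e ∈ E ∧ e.1 ≠ c ∧ e.2 ≠ c := by
    intro e; simp [hL, List.mem_filter]
  have hsub : ∀ e ∈ L, ∀ e' ∈ L, e = e' := by
    intro e he e' he'
    match L, h1, he, he' with
    | [x], _, he, he' => rw [List.mem_singleton.1 he, List.mem_singleton.1 he']
  have hex : ∃ z : Sym2 V, ∀ e ∈ L, s(f e.1, f e.2) = z := by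
    by_cases hne : ∃ e, e ∈ L
    · obtain ⟨e, he⟩ := hne
      exact ⟨s(f e.1, f e.2), fun e' he' => by rw [hsub e he e' he']⟩
    · exact ⟨s(f c, f c), fun e he => absurd ⟨e, he⟩ hne⟩
  obtain ⟨z, hz⟩ := hex
  refine ⟨f c, z, fun e he => ?_⟩
  induction e with
  | _ x y =>
  by_contra! hcon
  simp only [Sym2.mem_iff, not_or] at hcon
  obtain ⟨⟨hx, hy⟩, hne⟩ := hcon
  obtain ⟨a, b, ⟨-, hab | hab⟩, rfl, rfl⟩ := h x y he hx hy
  · exact hne (hz (a, b) ((hLmem _).2 ⟨hab, fun h => hx (by rw [← h]), fun h => hy (by rw [← h])⟩))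
  · exact hne (Sym2.eq_swap.trans
      (hz (b, a) ((hLmem _).2 ⟨hab, fun h => hy (by rw [← h]), fun h => hx (by rw [← h])⟩)))

theorem isoUpToIsolated_of_pat {V : Type u} {G : SimpleGraph V} {E : List (ℕ × ℕ)} {f : ℕ → V}
    (hi : Set.InjOn f (pat E).support) (hf : ∀ i j, (pat E).Adj i j → G.Adj (f i) (f j))
    (hs : ∀ x y, G.Adj x y → ∃ a b, (pat E).Adj a b ∧ f a = x ∧ f b = y)
    {n : ℕ} (H : SimpleGraph (Fin n)) (hH : ∀ i j : Fin n, H.Adj i j ↔ (pat E).Adj i j)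
    (hn : ∀ a ∈ (pat E).support, a < n) : IsoUpToIsolated G H := by
  refine isoUpToIsolated_of_embedding (fun i : Fin n => f i) ?_
    (fun i j hij => hf _ _ ((hH i j).1 hij)) ?_
  · rintro i ⟨j, hij⟩ i' ⟨j', hij'⟩ h
    exact Fin.ext (hi ⟨_, (hH _ _).1 hij⟩ ⟨_, (hH _ _).1 hij'⟩ h)
  · intro x y hxy
    obtain ⟨a, b, hab, rfl, rfl⟩ := hs x y hxy
    exact ⟨⟨a, hn a ⟨b, hab⟩⟩, ⟨b, hn b ⟨a, hab.symm⟩⟩, (hH _ _).2 hab, rfl, rfl⟩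

theorem cycleGraph_five_adj_iff (i j : Fin 5) :
    (SimpleGraph.cycleGraph 5).Adj i j ↔ (pat c5List).Adj i j := by
  change _ ↔ ((i : ℕ) ≠ j ∧ (((i : ℕ), (j : ℕ)) ∈ c5List ∨ ((j : ℕ), (i : ℕ)) ∈ c5List))
  revert i j; decide

theorem net_adj_iff (i j : Fin 6) : net.Adj i j ↔ (pat netList).Adj i j := by
  change _ ↔ ((i : ℕ) ≠ j ∧ (((i : ℕ), (j : ℕ)) ∈ netList ∨ ((j : ℕ), (i : ℕ)) ∈ netList))
  revert i j; decide

theorem cycle_or_net_of_not_terminates {V : Type u} {G : SimpleGraph V} (ht : ¬ Terminates G)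
    (hx : ¬ Explodes G) :
    IsoUpToIsolated G (SimpleGraph.cycleGraph 5) ∨ IsoUpToIsolated G net := by
  classical
  have hns : ¬ NearStar G := fun h => ht h.terminates
  have hstart : EmbedsIn (pat [(0, 1)]) G := by
    have : ∃ x y, G.Adj x y := by
      by_contra! h
      exact ht (terminates_of_edge 0 h)
    obtain ⟨x, y, hxy⟩ := this
    refine embedsIn_cons (f := fun n => if n = 0 then x else y) ?_ ?_ (by simpa using hxy)
    · have : (pat []).support ∪ {0, 1} ⊆ ({0, 1} : Set ℕ) := by
        rintro c (⟨d, -, h⟩ | h)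
        · simp at h
        · exact h
      refine Set.InjOn.mono this ?_
      rintro a (rfl | rfl) b (rfl | rfl) h
      · rfl
      · exact absurd h (by simpa using hxy.ne)
      · exact absurd h (by simpa using hxy.ne')
      · rfl
    · rintro i j ⟨-, h⟩
      simp at h
  have hne : (patterns.toFinset.filter fun E => EmbedsIn (pat E) G).Nonempty :=
    ⟨[(0, 1)], Finset.mem_filter.2 ⟨by decide, hstart⟩⟩
  obtain ⟨E, hE, hmax⟩ := Finset.exists_max_image _ List.length hne
  simp only [Finset.mem_filter, List.mem_toFinset] at hE hmax
  obtain ⟨hE, f, hi, hf⟩ := hE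
  have hasc := (patterns_wellFormed E hE).1
  have hn : ∀ a ∈ (pat E).support, a < bound E := fun a => lt_bound_of_mem_support hasc
  have hcn : ∀ c, centre E = some c → c < bound E := fun c hc =>
    hn c ((mem_verts hasc).1 (List.mem_of_find?_eq_some hc))
  -- An uncovered edge off the centre would give an explosion or an embedded pattern with one more
  -- edge, against maximality.
  have key : ∀ x y, G.Adj x y → (∀ c, centre E = some c → f c ≠ x ∧ f c ≠ y) →
      ∃ a b, (pat E).Adj a b ∧ f a = x ∧ f b = y := by
    intro x y hxy hc
    by_contra hnew
    obtain ⟨e, he, hlt, hmem, hemb, hec⟩ := exists_extension hasc hn hi hf hxy hnew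
    rcases exists_pattern_of_extension hE he hlt hmem
      (fun c h => hec c (hcn c h) (hc c h).1 (hc c h).2) with h | ⟨F, hF, hl, hFe⟩
    · exact hx (h.mono hemb)
    · have := hmax F ⟨hF, hFe.trans hemb⟩
      omega
  cases hcE : centre E with
  | some c =>
    refine absurd (nearStar_of_centre (f := f) hcE fun x y hxy h1 h2 => key x y hxy ?_) hns
    intro c' hc'
    obtain rfl : c = c' := Option.some.inj (hcE.symm.trans hc')
    exact ⟨h1, h2⟩
  | none =>
    have hs : ∀ x y, G.Adj x y → ∃ a b, (pat E).Adj a b ∧ f a = x ∧ f b = y :=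
      fun x y hxy => key x y hxy fun c hc => by simp [hcE] at hc
    have h := isResolved_eq_true
    simp only [isResolved, List.all_eq_true] at h
    have h := h E hE
    rw [hcE, Bool.or_eq_true, Bool.or_eq_true, Bool.or_eq_true] at h
    rcases h with ((h | h) | h) | h
    · simp at h
    -- The pattern covers all edges of `G`, so inverting `f` on the support embeds `G` in the
    -- terminating pattern.
    · refine absurd ((terminates_of_terminatesList 7 hasc h).of_embedsIn ?_) ht
      choose! g hg using fun (x : V) (hx : x ∈ G.support) =>
        show ∃ a, a ∈ (pat E).support ∧ f a = x by
          obtain ⟨y, hxy⟩ := hx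
          obtain ⟨a, b, hab, ha, -⟩ := hs x y hxy
          exact ⟨a, ⟨b, hab⟩, ha⟩
      refine ⟨g, ?_, ?_⟩
      · intro x hx y hy hxy
        rw [← (hg x hx).2, ← (hg y hy).2, hxy]
      · intro x y hxy
        obtain ⟨a, b, hab, rfl, rfl⟩ := hs x y hxy
        have h1 := hg (f a) ⟨_, hxy⟩
        have h2 := hg (f b) ⟨_, hxy.symm⟩
        rw [hi h1.1 ⟨b, hab⟩ h1.2, hi h2.1 ⟨a, hab.symm⟩ h2.2]
        exact hab
    · obtain rfl := beq_iff_eq.1 h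
      exact Or.inl (isoUpToIsolated_of_pat hi hf hs _ cycleGraph_five_adj_iff hn)
    · obtain rfl := beq_iff_eq.1 h
      exact Or.inr (isoUpToIsolated_of_pat hi hf hs _ net_adj_iff hn)

end JumpGraph

theorem mainTheorem2 {V : Type u} [Finite V] (G : SimpleGraph V) :
    (JumpGraph.d G = ⊤ →
      ¬ JumpGraph.IsoUpToIsolated G (SimpleGraph.cycleGraph 5) →
      ¬ JumpGraph.IsoUpToIsolated G JumpGraph.net →
      Filter.Tendsto (fun k : ℕ => JumpGraph.numEdges G k) Filter.atTop Filter.atTop) ∧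
    (JumpGraph.Diverges G →
      Filter.Tendsto (fun k : ℕ => JumpGraph.numEdges G k) Filter.atTop Filter.atTop) := by
  have main : ¬ JumpGraph.Terminates G →
      ¬ JumpGraph.IsoUpToIsolated G (SimpleGraph.cycleGraph 5) →
      ¬ JumpGraph.IsoUpToIsolated G JumpGraph.net →
      Filter.Tendsto (fun k : ℕ => JumpGraph.numEdges G k) Filter.atTop Filter.atTop := by
    intro ht h5 hN
    by_contra hcon
    exact (JumpGraph.cycle_or_net_of_not_terminates ht fun h => hcon h.tendsto).elim h5 hN
  refine ⟨fun hd => main (JumpGraph.not_terminates_of_d_eq_top hd), fun ⟨ht, hc⟩ => main ht ?_ ?_⟩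
  · exact fun h => hc (JumpGraph.converges_of_isoUpToIsolated h
      JumpGraph.jump_cycleGraph_five_iso)
  · exact fun h => hc (JumpGraph.converges_of_isoUpToIsolated h JumpGraph.jump_net_iso)
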